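/- Let $d \ge 1$. The braid arrangement in $\mathbb{R}^d$ consists of the hyperplanes $\{x : x_i = x_j\}$, $1 \le i < j \le d$; the closures of the connected components of the complement of their union, together with all faces of these closed cones, form the fan $\mathcal{B}_{d-1}$. The normal fan of a non-empty polytope $P \subset \mathbb{R}^d$ is the set of the cones $N_F P = \{c \in \mathbb{R}^d : \langle c, x\rangle \ge \langle c, y\rangle \text{ for all } x \in F,\ y \in P\}$, where $F$ ranges over the non-empty faces of $P$. A polytope is inscribed if its vertices lie on a common sphere. The inscribed cone of $\mathcal{B}_{d-1}$ is the set of all inscribed polytopes in $\mathbb{R}^d$ with normal fan $\mathcal{B}_{d-1}$, modulo translations, and the closed inscribed cone is its closure in the Hausdorff metric. For $z \in \mathbb{R}^d$ let $P(z) = \operatorname{conv}\{(z_{\sigma(1)},\dots,z_{\sigma(d)}) : \sigma \in S_d\}$ be the permutahedron of $z$, and let the hypersimplex $\Delta(d,k)$ be the convex hull of the vectors in $\{0,1\}^d$ with exactly $k$ entries equal to $1$. Let $P$ be a polytope (representing a translation class) in the closed inscribed cone of $\mathcal{B}_{d-1}$. Then there is a point $c(P)$ in the affine hull of $P$ that is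 equidistant from all vertices of $P$, and there is $z \in \mathbb{R}^d$ with $z_1 \le z_2 \le \cdots \le z_d$ such that $$P - c(P) \;=\; P(z) \;=\; z_1\,\Delta(d,d) + \sum_{i=2}^{d} (z_i - z_{i-1})\,\Delta(d, d-i+1),$$ where sums are Minkowski sums. Thus, up to translation (note that $\Delta(d,d)$ is the single point $(1,\dots,1)$), $P$ is a nonnegative combination of the hypersimplices $\Delta(d,1),\dots,\Delta(d,d-1)$. Moreover $P - c(P)$ is invariant under the action of $S_d$ that permutes the coordinates. -/

import Mathlib

open scoped Pointwise
open TopologicalSpace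

noncomputable section

/-- The Euclidean space `ℝ^d`. -/
abbrev EucSpace (d : ℕ) : Type := EuclideanSpace ℝ (Fin d)

/-- `P` is a non-empty convex polytope: the convex hull of a non-empty finite set of points. -/
def IsPolytope {d : ℕ} (P : Set (EucSpace d)) : Prop :=
  ∃ s : Finset (EucSpace d), s.Nonempty ∧ P = convexHull ℝ (s : Set (EucSpace d))

/-- The set `P^c` of points of `P` that maximize the linear function `x ↦ ⟪c, x⟫` over `P`.
The non-empty faces of a polytope, and of a polyhedral cone, are exactly its non-empty subsets
of this form. -/
def maxFace {d : ℕ} (P : Set (EucSpace d)) (c : EucSpace d) : Set (EucSpace d) :=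
  {x | x ∈ P ∧ ∀ y ∈ P, inner ℝ c y ≤ inner ℝ c x}

/-- `F` is a non-empty face of the polytope or polyhedral cone `P`. -/
def IsFaceOf {d : ℕ} (F P : Set (EucSpace d)) : Prop :=
  F.Nonempty ∧ ∃ c : EucSpace d, F = maxFace P c

/-- The normal cone `N_F P = {c | F ⊆ P^c}`. -/
def normalConeAt {d : ℕ} (P F : Set (EucSpace d)) : Set (EucSpace d) :=
  {c | F ⊆ maxFace P c}

/-- The normal fan of `P`: the collection of the normal cones at the non-empty faces of `P`. -/
def normalFan {d : ℕ} (P : Set (EucSpace d)) : Set (Set (EucSpace d)) :=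
  {C | ∃ F : Set (EucSpace d), IsFaceOf F P ∧ C = normalConeAt P F}

/-- `P` is inscribed: its vertices lie on a common sphere. -/
def IsInscribed {d : ℕ} (P : Set (EucSpace d)) : Prop :=
  ∃ (c : EucSpace d) (r : ℝ), 0 < r ∧ Set.extremePoints ℝ P ⊆ Metric.sphere c r

/-- `c` is the center `c(P)` of an inscribed polytope `P`, that is, the center of the unique
inscribing sphere of `P` relative to its affine hull. The radius is `0` if `P` is a point. -/
def IsInscribedCenter {d : ℕ} (P : Set (EucSpace d)) (c : EucSpace d) : Prop :=
  c ∈ affineSpan ℝ P ∧ ∃ r : ℝ, Set.extremePoints ℝ P ⊆ Metric.sphere c r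

/-- The inscribed cone of a fan: the inscribed polytopes with that normal fan. This set is
invariant under translations and stands for the corresponding set of translation classes. -/
def inscribedCone {d : ℕ} (𝒩 : Set (Set (EucSpace d))) : Set (NonemptyCompacts (EucSpace d)) :=
  {P | IsPolytope (P : Set (EucSpace d)) ∧ IsInscribed (P : Set (EucSpace d)) ∧
    normalFan (P : Set (EucSpace d)) = 𝒩}

/-- The closed inscribed cone: the closure of the inscribed cone in the Hausdorff metric, which
is the metric of `NonemptyCompacts`. As `inscribedCone 𝒩` is invariant under translations, so is
its closure, which stands for the closure of the set of translation classes. -/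
def closedInscribedCone {d : ℕ} (𝒩 : Set (Set (EucSpace d))) :
    Set (NonemptyCompacts (EucSpace d)) :=
  closure (inscribedCone 𝒩)

/-- The complement in `ℝ^d` of the union of the hyperplanes `x_i = x_j`, `i < j`, of the
braid arrangement. -/
def braidComplement (d : ℕ) : Set (EucSpace d) :=
  (⋃ (i : Fin d) (j : Fin d) (_ : i < j), {x : EucSpace d | x i = x j})ᶜ

/-- The regions of the braid arrangement: the closures of the connected components of the
complement of its hyperplanes. -/
def braidRegions (d : ℕ) : Set (Set (EucSpace d)) :=
  {R | ∃ x ∈ braidComplement d, R = closure (connectedComponentIn (braidComplement d) x)}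

/-- The fan of the braid arrangement: the regions together with all their faces. -/
def braidFan (d : ℕ) : Set (Set (EucSpace d)) :=
  {C | ∃ R ∈ braidRegions d, IsFaceOf C R}

/-- The action of a permutation on `ℝ^d` by permuting coordinates. -/
def permuteCoords {d : ℕ} (σ : Equiv.Perm (Fin d)) (x : EucSpace d) : EucSpace d :=
  WithLp.toLp 2 (fun i => x (σ i))

/-- The permutahedron `P(z)`: the convex hull of all points that arise from `z` by permuting
its coordinates. -/
def permutahedron {d : ℕ} (z : EucSpace d) : Set (EucSpace d) :=
  convexHull ℝ (Set.range fun σ : Equiv.Perm (Fin d) => permuteCoords σ z)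

/-- The hypersimplex `Δ(d, k)`: the convex hull of the `0/1`-vectors in `ℝ^d` with exactly `k`
entries equal to `1`. -/
def hypersimplex (d k : ℕ) : Set (EucSpace d) :=
  convexHull ℝ {x : EucSpace d | (∀ i, x i = 0 ∨ x i = 1) ∧ {i : Fin d | x i = 1}.ncard = k}

end

/-! ### Permutahedra, hypersimplices and Minkowski sums. -/

section Permutahedron

variable {d : ℕ}

/-! Let `P` be inscribed in a sphere around `c`, with the braid fan as normal fan. For each
permutation `τ` there is a vertex `v τ` whose normal cone is `braidCone τ`
(`exists_vertices_of_normalFan_eq_braidFan`). The vertices of two adjacent regions are equidistant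
from `c`, and their difference is perpendicular to the common wall, so seen from `c` they are mirror
images in that wall (`eq_permuteCoords_swap`). These reflections are transpositions of coordinates.
Adjacent transpositions generate the symmetric group, so the vectors `v τ - c` form a single orbit
and `P = c + P(z)` (`exists_eq_vadd_permutahedron`).

Such translates, with `z` monotone of sum zero, form a closed set in the Hausdorff metric
(`isClosed_image_permutahedronCompacts`), which therefore contains the closed inscribed cone. The
hypersimplex formula holds because `P(z)` is additive in monotone `z` (`permutahedron_add`) and a
monotone vector is a combination of step vectors, nonnegative except perhaps for the constant one.
-/

theorem EucSpace.inner_eq_sum (x y : EucSpace d) : inner ℝ x y = ∑ i, x i * y i := by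
  simp [PiLp.inner_apply, mul_comm]

/-- A point whose value in every direction is at most the value of some point of a closed convex
set lies in that set. -/
theorem mem_of_forall_exists_inner_le {K : Set (EucSpace d)} (hK : Convex ℝ K)
    (hc : IsClosed K) {x : EucSpace d}
    (h : ∀ c : EucSpace d, ∃ y ∈ K, inner ℝ c x ≤ inner ℝ c y) : x ∈ K := by
  by_contra hx
  obtain ⟨f, u, hf, hu⟩ := geometric_hahn_banach_closed_point hK hc hx
  obtain ⟨y, hy, hxy⟩ := h ((InnerProductSpace.toDual ℝ (EucSpace d)).symm f)
  simp only [InnerProductSpace.toDual_symm_apply] at hxy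
  linarith [hf y hy]

@[simp]
theorem permuteCoords_apply (σ : Equiv.Perm (Fin d)) (x : EucSpace d) (i : Fin d) :
    permuteCoords σ x i = x (σ i) := rfl

/-- Permuting coordinates, as a linear map. -/
def permuteCoordsLinear (σ : Equiv.Perm (Fin d)) : EucSpace d →ₗ[ℝ] EucSpace d where
  toFun := permuteCoords σ
  map_add' _ _ := rfl
  map_smul' _ _ := rfl

theorem permuteCoords_add (σ : Equiv.Perm (Fin d)) (x y : EucSpace d) :
    permuteCoords σ (x + y) = permuteCoords σ x + permuteCoords σ y := rfl

@[simp]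
theorem permuteCoords_one (x : EucSpace d) : permuteCoords 1 x = x := rfl

/-- The action is by precomposition, hence a right action: the product is reversed, and inverses
appear below for this reason. -/
theorem permuteCoords_permuteCoords (σ τ : Equiv.Perm (Fin d)) (x : EucSpace d) :
    permuteCoords σ (permuteCoords τ x) = permuteCoords (τ * σ) x := rfl

theorem permuteCoords_injective (σ : Equiv.Perm (Fin d)) :
    Function.Injective (permuteCoords σ) := fun x y h => by
  simpa [permuteCoords_permuteCoords] using congrArg (permuteCoords σ⁻¹) h

theorem norm_permuteCoords (σ : Equiv.Perm (Fin d)) (x : EucSpace d) :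
    ‖permuteCoords σ x‖ = ‖x‖ := by
  rw [EuclideanSpace.norm_eq, EuclideanSpace.norm_eq]
  congr 1
  exact Equiv.sum_comp σ fun i => ‖x i‖ ^ 2

theorem permuteCoords_mem_permutahedron (σ : Equiv.Perm (Fin d)) (z : EucSpace d) :
    permuteCoords σ z ∈ permutahedron z :=
  subset_convexHull ℝ _ ⟨σ, rfl⟩

theorem convex_permutahedron (z : EucSpace d) : Convex ℝ (permutahedron z) :=
  convex_convexHull ℝ _

theorem isCompact_permutahedron (z : EucSpace d) : IsCompact (permutahedron z) :=
  Set.Finite.isCompact_convexHull (𝕜 := ℝ) (Set.finite_range _)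

theorem permutahedron_permuteCoords (τ : Equiv.Perm (Fin d)) (z : EucSpace d) :
    permutahedron (permuteCoords τ z) = permutahedron z := by
  unfold permutahedron
  congr 1
  exact (Equiv.mulLeft τ).surjective.range_comp fun σ => permuteCoords σ z

theorem image_permuteCoords_permutahedron (τ : Equiv.Perm (Fin d)) (z : EucSpace d) :
    permuteCoords τ '' permutahedron z = permutahedron z := by
  unfold permutahedron
  have h := (permuteCoordsLinear τ).image_convexHull
    (Set.range fun σ : Equiv.Perm (Fin d) => permuteCoords σ z)
  refine h.trans ?_
  rw [← Set.range_comp]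
  congr 1
  exact (Equiv.mulRight τ).surjective.range_comp fun σ => permuteCoords σ z

theorem permutahedron_smul (a : ℝ) (z : EucSpace d) :
    permutahedron (a • z) = a • permutahedron z := by
  unfold permutahedron
  rw [← convexHull_smul (𝕜 := ℝ), ← Set.image_smul, ← Set.range_comp]
  rfl

theorem permutahedron_zero : permutahedron (0 : EucSpace d) = 0 := by
  have h : (fun σ : Equiv.Perm (Fin d) => permuteCoords σ (0 : EucSpace d)) = fun _ => 0 := rfl
  rw [permutahedron, h, Set.range_const, convexHull_singleton, Set.singleton_zero]

/-- The rearrangement inequality on a permutahedron. -/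
theorem inner_le_of_mem_permutahedron {z c p : EucSpace d} (hz : Monotone fun i => z i)
    {τ : Equiv.Perm (Fin d)} (hc : Monotone fun i => c (τ i)) (hp : p ∈ permutahedron z) :
    inner ℝ c p ≤ inner ℝ c (permuteCoords τ⁻¹ z) := by
  have hconv : Convex ℝ {p : EucSpace d | inner ℝ c p ≤ inner ℝ c (permuteCoords τ⁻¹ z)} :=
    convex_halfSpace_le (innerₛₗ ℝ c).isLinear _
  refine convexHull_min ?_ hconv hp
  rintro _ ⟨σ, rfl⟩
  simp only [Set.mem_ofPred_eq, EucSpace.inner_eq_sum, permuteCoords_apply]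
  rw [← Equiv.sum_comp τ, ← Equiv.sum_comp τ (fun i => c i * z (τ⁻¹ i))]
  simp only [Equiv.Perm.inv_def, Equiv.symm_apply_apply]
  exact (hc.monovary hz).sum_mul_comp_perm_le_sum_mul (σ := σ * τ)

/-- In a direction `c`, the permutation that sorts `c` yields a maximizer on `P(x)` and on `P(y)` at
once, so the two maxima add up to the value at one vertex of `P(x + y)`. -/
theorem permutahedron_add {x y : EucSpace d} (hx : Monotone fun i => x i)
    (hy : Monotone fun i => y i) :
    permutahedron (x + y) = permutahedron x + permutahedron y := by
  apply Set.Subset.antisymm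
  · refine convexHull_min ?_ ((convex_permutahedron x).add (convex_permutahedron y))
    rintro _ ⟨σ, rfl⟩
    exact Set.add_mem_add (permuteCoords_mem_permutahedron σ x)
      (permuteCoords_mem_permutahedron σ y)
  · rintro _ ⟨p, hp, q, hq, rfl⟩
    refine mem_of_forall_exists_inner_le (convex_permutahedron _)
      (isCompact_permutahedron _).isClosed fun c => ?_
    have hc := Tuple.monotone_sort fun i => c i
    refine ⟨_, permuteCoords_mem_permutahedron (Tuple.sort fun i => c i)⁻¹ (x + y), ?_⟩
    rw [permuteCoords_add, inner_add_right, inner_add_right]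
    exact add_le_add (inner_le_of_mem_permutahedron hx hc hp)
      (inner_le_of_mem_permutahedron hy hc hq)

theorem permutahedron_sum {ι : Type*} (s : Finset ι) (u : ι → EucSpace d)
    (hu : ∀ i ∈ s, Monotone fun j => u i j) :
    permutahedron (∑ i ∈ s, u i) = ∑ i ∈ s, permutahedron (u i) := by
  classical
  induction s using Finset.induction_on with
  | empty => simpa using permutahedron_zero
  | insert a s ha ih =>
    have hs : ∀ i ∈ s, Monotone fun j => u i j := fun i hi => hu i (Finset.mem_insert_of_mem hi)
    rw [Finset.sum_insert ha, Finset.sum_insert ha, permutahedron_add, ih hs]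
    · exact hu a (Finset.mem_insert_self a s)
    · intro j k hjk
      simp only [WithLp.ofLp_sum, Finset.sum_apply]
      exact Finset.sum_le_sum fun i hi => hs i hi hjk

/-- The vector in `ℝ^d` whose last `k` entries are `1` and whose other entries are `0`. -/
noncomputable def stepVector (d k : ℕ) : EucSpace d :=
  WithLp.toLp 2 fun i => if d ≤ i + k then 1 else 0

theorem stepVector_apply (k : ℕ) (i : Fin d) :
    stepVector d k i = if d ≤ i + k then 1 else 0 := rfl

theorem monotone_stepVector (k : ℕ) : Monotone fun i => stepVector d k i := by
  intro i j hij
  have : (i : ℕ) ≤ j := hij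
  simp only [stepVector_apply]
  split_ifs <;> first | omega | norm_num

theorem stepVector_eq_zero_or_one (k : ℕ) (i : Fin d) :
    stepVector d k i = 0 ∨ stepVector d k i = 1 := by
  rw [stepVector_apply]
  split_ifs <;> simp

theorem ncard_stepVector_eq_one {k : ℕ} (hk : k ≤ d) :
    {i : Fin d | stepVector d k i = 1}.ncard = k := by
  have h : {i : Fin d | stepVector d k i = 1} = Set.range (fun j : Fin k =>
      (⟨d - k + j, by omega⟩ : Fin d)) := by
    ext i
    simp only [Set.mem_ofPred_eq, stepVector_apply, Set.mem_range, Fin.ext_iff]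
    constructor
    · intro hi
      have : d ≤ i + k := by by_contra h; simp [h] at hi
      exact ⟨⟨i - (d - k), by omega⟩, by simp only; omega⟩
    · rintro ⟨j, hj⟩
      rw [if_pos (by omega)]
  rw [h, ← Set.image_univ, Set.ncard_image_of_injective, Set.ncard_univ, Nat.card_fin]
  intro a b hab
  simpa [Fin.ext_iff] using hab

/-- Two vectors with entries `0` and `1` and equally many ones agree up to a permutation of the
coordinates. -/
theorem exists_permuteCoords_eq {x y : EucSpace d} (hx : ∀ i, x i = 0 ∨ x i = 1)
    (hy : ∀ i, y i = 0 ∨ y i = 1)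
    (h : {i : Fin d | x i = 1}.ncard = {i : Fin d | y i = 1}.ncard) :
    ∃ σ : Equiv.Perm (Fin d), permuteCoords σ y = x := by
  classical
  obtain ⟨e⟩ : Nonempty ({i : Fin d // x i = 1} ≃ {i : Fin d // y i = 1}) :=
    (Finite.card_eq).1 h
  refine ⟨e.extendSubtype, ?_⟩
  ext i
  rw [permuteCoords_apply]
  by_cases hi : x i = 1
  · rw [hi, e.extendSubtype_mem i hi]
  · rw [(hx i).resolve_right hi, (hy _).resolve_right (e.extendSubtype_not_mem i hi)]

theorem hypersimplex_eq_permutahedron {k : ℕ} (hk : k ≤ d) :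
    hypersimplex d k = permutahedron (stepVector d k) := by
  unfold hypersimplex permutahedron
  congr 1
  ext x
  constructor
  · rintro ⟨hx, hc⟩
    exact exists_permuteCoords_eq hx (stepVector_eq_zero_or_one k)
      (hc.trans (ncard_stepVector_eq_one hk).symm)
  · rintro ⟨σ, rfl⟩
    refine ⟨fun i => stepVector_eq_zero_or_one k (σ i), ?_⟩
    refine Eq.trans ?_ (ncard_stepVector_eq_one hk)
    exact Set.ncard_congr (fun i _ => σ i) (fun _ h => h) (fun _ _ _ _ h => σ.injective h)
      fun i hi => ⟨σ⁻¹ i, by simpa using hi, by simp⟩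

/-- Telescoping: the jump between entries `i` and `i + 1` contributes to exactly the coordinates `j
> i`, which are the last `n - i`. -/
theorem eq_sum_stepVector {n : ℕ} (z : EucSpace (n + 1)) :
    z = z 0 • stepVector (n + 1) (n + 1) +
      ∑ i : Fin n, (z i.succ - z i.castSucc) • stepVector (n + 1) (n - (i : ℕ)) := by
  ext j
  simp only [PiLp.add_apply, PiLp.smul_apply, WithLp.ofLp_sum, Finset.sum_apply, smul_eq_mul,
    stepVector_apply, Nat.le_add_left, if_true, mul_one]
  have hstep : ∀ (i : Fin n) (j : Fin (n + 1)),
      n + 1 ≤ (j : ℕ) + (n - (i : ℕ)) ↔ (i : ℕ) < j := fun i j => by omega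
  simp only [hstep]
  induction j using Fin.induction with
  | zero => simp
  | succ j ih =>
    have hsplit : ∀ i : Fin n, (if (i : ℕ) < j.succ then (1 : ℝ) else 0) =
        (if (i : ℕ) < j.castSucc then 1 else 0) + if i = j then 1 else 0 := by
      intro i
      simp only [Fin.val_succ, Fin.val_castSucc, Fin.ext_iff]
      split_ifs <;> first | omega | norm_num
    simp only [hsplit, mul_add, Finset.sum_add_distrib, mul_ite, mul_one, mul_zero,
      Finset.sum_ite_eq', Finset.mem_univ, if_true]
    simp only [mul_ite, mul_one, mul_zero] at ih
    linarith

theorem permutahedron_eq_sum_hypersimplex {n : ℕ} {z : EucSpace (n + 1)}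
    (hz : Monotone fun i => z i) :
    permutahedron z = z 0 • hypersimplex (n + 1) (n + 1) +
      ∑ i : Fin n, (z i.succ - z i.castSucc) • hypersimplex (n + 1) (n - (i : ℕ)) := by
  have hconst : Monotone fun j => (z 0 • stepVector (n + 1) (n + 1)) j := fun j k _ => by
    simp [stepVector_apply]
  have hmono : ∀ i : Fin n, Monotone fun j =>
      ((z i.succ - z i.castSucc) • stepVector (n + 1) (n - (i : ℕ))) j := fun i j k hjk =>
    mul_le_mul_of_nonneg_left (monotone_stepVector _ hjk)
      (sub_nonneg.2 (hz i.castSucc_le_succ))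
  conv_lhs => rw [eq_sum_stepVector z]
  rw [permutahedron_add hconst, permutahedron_sum _ _ fun i _ => hmono i, permutahedron_smul,
    hypersimplex_eq_permutahedron le_rfl]
  · refine congrArg _ (Finset.sum_congr rfl fun i _ => ?_)
    rw [permutahedron_smul, hypersimplex_eq_permutahedron (by omega)]
  · intro j k hjk
    simp only [WithLp.ofLp_sum, Finset.sum_apply]
    exact Finset.sum_le_sum fun i _ => hmono i hjk

/-- The center of a permutahedron: the average over the cyclic shifts of a vector with entries
summing to `0`. -/
theorem zero_mem_permutahedron {n : ℕ} {z : EucSpace (n + 1)} (hz : ∑ i, z i = 0) :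
    (0 : EucSpace (n + 1)) ∈ permutahedron z := by
  have h := (convex_permutahedron z).sum_mem (t := Finset.univ)
    (w := fun _ : Fin (n + 1) => ((n : ℝ) + 1)⁻¹)
    (z := fun k => permuteCoords (Equiv.addRight k) z) (fun _ _ => by positivity)
    (by simp; field_simp) (fun k _ => permuteCoords_mem_permutahedron _ z)
  convert h using 1
  ext i
  simp only [WithLp.ofLp_sum, Finset.sum_apply, PiLp.smul_apply, permuteCoords_apply,
    smul_eq_mul, ← Finset.mul_sum]
  have := Equiv.sum_comp (Equiv.addLeft i) fun k => z k
  simp only [Equiv.coe_addLeft] at this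
  simp [this, hz]

end Permutahedron

/-! ### The braid fan and the inscribed polytopes that have it as normal fan. -/

section BraidArrangement

variable {d : ℕ}

/-- The open region of the braid arrangement on which `x (τ 0) < x (τ 1) < ⋯`. -/
def braidChamber (τ : Equiv.Perm (Fin d)) : Set (EucSpace d) :=
  {x | StrictMono fun j => x (τ j)}

/-- The closed region of the braid arrangement on which `x (τ 0) ≤ x (τ 1) ≤ ⋯`. -/
def braidCone (τ : Equiv.Perm (Fin d)) : Set (EucSpace d) :=
  {x | Monotone fun j => x (τ j)}

theorem mem_braidComplement {x : EucSpace d} :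
    x ∈ braidComplement d ↔ Function.Injective fun i => x i := by
  simp only [braidComplement, Set.mem_compl_iff, Set.mem_iUnion, Set.mem_ofPred_eq, not_exists]
  constructor
  · intro h i j hij
    rcases lt_trichotomy i j with hlt | heq | hlt
    · exact absurd hij (h i j hlt)
    · exact heq
    · exact absurd hij.symm (h j i hlt)
  · exact fun h i j hlt hij => hlt.ne (h hij)

theorem braidChamber_subset_braidComplement (τ : Equiv.Perm (Fin d)) :
    braidChamber τ ⊆ braidComplement d := fun x hx => by
  rw [mem_braidComplement]
  intro i j hij
  have := hx.injective (a₁ := τ⁻¹ i) (a₂ := τ⁻¹ j) (by simpa using hij)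
  simpa using this

theorem convex_braidChamber (τ : Equiv.Perm (Fin d)) : Convex ℝ (braidChamber τ) := by
  intro x hx y hy a b ha hb hab i j hij
  have h1 := hx hij
  have h2 := hy hij
  simp only [PiLp.add_apply, PiLp.smul_apply, smul_eq_mul] at h1 h2 ⊢
  rcases ha.eq_or_lt with rfl | ha
  · obtain rfl : b = 1 := by linarith
    simpa using h2
  · nlinarith [mul_lt_mul_of_pos_left h1 ha, mul_le_mul_of_nonneg_left h2.le hb]

theorem connectedComponentIn_braidComplement {τ : Equiv.Perm (Fin d)} {x : EucSpace d}
    (hx : x ∈ braidChamber τ) :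
    connectedComponentIn (braidComplement d) x = braidChamber τ := by
  apply Set.Subset.antisymm
  · intro y hy i j hij
    by_contra hlt
    -- If two coordinates changed order within the component, their difference would vanish
    -- somewhere on it, at a point of a hyperplane.
    have hcont : ContinuousOn (fun w : EucSpace d => w (τ j) - w (τ i))
        (connectedComponentIn (braidComplement d) x) := by fun_prop
    obtain ⟨w, hw, hw0⟩ := isPreconnected_connectedComponentIn.intermediate_value hy
      (mem_connectedComponentIn (braidChamber_subset_braidComplement τ hx)) hcont
      (show (0 : ℝ) ∈ Set.Icc _ _ from ⟨by simp only at hlt; linarith, (sub_pos.2 (hx hij)).le⟩)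
    have hinj := mem_braidComplement.1 (connectedComponentIn_subset _ _ hw)
    exact hij.ne' (τ.injective (hinj (sub_eq_zero.1 hw0)))
  · exact (convex_braidChamber τ).isPreconnected.subset_connectedComponentIn hx
      (braidChamber_subset_braidComplement τ)

/-- A point of the open region of the braid arrangement belonging to `τ`. -/
noncomputable def braidPoint (τ : Equiv.Perm (Fin d)) : EucSpace d :=
  WithLp.toLp 2 fun i => ((τ⁻¹ i : Fin d) : ℝ)

theorem braidPoint_apply_apply (τ : Equiv.Perm (Fin d)) (j : Fin d) :
    braidPoint τ (τ j) = (j : ℝ) := by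
  simp [braidPoint]

theorem braidPoint_mem_braidChamber (τ : Equiv.Perm (Fin d)) :
    braidPoint τ ∈ braidChamber τ := fun i j hij => by
  simpa only [braidPoint_apply_apply, Nat.cast_lt, Fin.val_fin_lt] using hij

theorem isClosed_braidCone (τ : Equiv.Perm (Fin d)) : IsClosed (braidCone τ) := by
  simp only [braidCone, Monotone, Set.ofPred_forall]
  exact isClosed_iInter fun i => isClosed_iInter fun j => isClosed_iInter fun _ =>
    isClosed_le (by fun_prop) (by fun_prop)

theorem closure_braidChamber (τ : Equiv.Perm (Fin d)) :
    closure (braidChamber τ) = braidCone τ := by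
  apply Set.Subset.antisymm
  · exact closure_minimal (fun x hx => StrictMono.monotone hx) (isClosed_braidCone τ)
  · intro x hx
    have hcont : Filter.Tendsto (fun ε : ℝ => x + ε • braidPoint τ) (nhdsWithin 0 (Set.Ioi 0))
        (nhds x) := by
      have : Continuous fun ε : ℝ => x + ε • braidPoint τ := by fun_prop
      simpa using (this.tendsto 0).mono_left nhdsWithin_le_nhds
    refine mem_closure_of_tendsto hcont ?_
    filter_upwards [self_mem_nhdsWithin] with ε hε i j hij
    exact add_lt_add_of_le_of_lt (hx hij.le)
      (mul_lt_mul_of_pos_left (braidPoint_mem_braidChamber τ hij) hε)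

theorem braidCone_mem_braidFan (τ : Equiv.Perm (Fin d)) : braidCone τ ∈ braidFan d := by
  have hmem := braidPoint_mem_braidChamber τ
  refine ⟨braidCone τ, ⟨braidPoint τ, braidChamber_subset_braidComplement τ hmem, ?_⟩,
    ⟨braidPoint τ, StrictMono.monotone hmem⟩, 0, ?_⟩
  · rw [connectedComponentIn_braidComplement hmem, closure_braidChamber]
  · ext x
    simp [maxFace]

theorem permuteCoords_inv_mem_braidCone (τ : Equiv.Perm (Fin d)) {g : EucSpace d}
    (hg : Monotone fun i => g i) : permuteCoords τ⁻¹ g ∈ braidCone τ := by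
  simpa [braidCone] using hg

theorem inner_permuteCoords_inv (τ : Equiv.Perm (Fin d)) (g x : EucSpace d) :
    inner ℝ (permuteCoords τ⁻¹ g) x = inner ℝ g (permuteCoords τ x) := by
  rw [EucSpace.inner_eq_sum, EucSpace.inner_eq_sum, ← Equiv.sum_comp τ]
  simp

/-- The indicator vector of an up-set of coordinates is monotone. -/
theorem monotone_indicator (p : Fin d → Prop) [DecidablePred p]
    (hp : ∀ i j, i ≤ j → p i → p j) :
    Monotone fun i => (WithLp.toLp 2 fun i => if p i then (1 : ℝ) else 0 : EucSpace d) i := by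
  intro i j hij
  have := hp i j hij
  simp only
  split_ifs <;> simp_all

/-- Each coordinate functional is a difference of two monotone indicators, so the monotone vectors
span the space. -/
theorem apply_eq_inner_sub_inner (w : EucSpace d) (j : Fin d) :
    w j = inner ℝ (WithLp.toLp 2 fun i => if j ≤ i then (1 : ℝ) else 0 : EucSpace d) w -
      inner ℝ (WithLp.toLp 2 fun i => if j < i then (1 : ℝ) else 0 : EucSpace d) w := by
  rw [EucSpace.inner_eq_sum, EucSpace.inner_eq_sum, ← Finset.sum_sub_distrib,
    Finset.sum_eq_single j]
  · simp
  · intro i _ hi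
    simp [le_iff_lt_or_eq, hi.symm]
  · simp

theorem eq_zero_of_inner_monotone_eq_zero {w : EucSpace d}
    (h : ∀ g : EucSpace d, (Monotone fun i => g i) → inner ℝ g w = 0) : w = 0 := by
  ext j
  rw [apply_eq_inner_sub_inner, h, h]
  · simp
  · exact monotone_indicator _ fun i k hik hi => hi.trans_le hik
  · exact monotone_indicator _ fun i k hik hi => hi.trans hik

/-- Two vectors of equal norm whose difference is orthogonal to the wall `x_i = x_{i + 1}` of the
cone of monotone vectors are equal or mirror images of each other in this wall. -/
theorem eq_permuteCoords_swap {n : ℕ} {a b : EucSpace (n + 1)} (i : Fin n)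
    (h : ∀ g : EucSpace (n + 1), (Monotone fun j => g j) → g i.castSucc = g i.succ →
      inner ℝ g a = inner ℝ g b) (hnorm : ‖a‖ = ‖b‖) (hab : a ≠ b) :
    b = permuteCoords (Equiv.swap i.castSucc i.succ) a := by
  have hne : i.castSucc ≠ i.succ := i.castSucc_lt_succ.ne
  -- For such `j`, both indicators from `apply_eq_inner_sub_inner` take equal values at `i.castSucc`
  -- and `i.succ`, so they lie on the wall.
  have hout : ∀ j, j ≠ i.castSucc → j ≠ i.succ → a j = b j := by
    intro j h1 h2
    have h1' : (j : ℕ) ≠ i := fun h => h1 (Fin.ext h)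
    have h2' : (j : ℕ) ≠ i + 1 := fun h => h2 (Fin.ext h)
    rw [apply_eq_inner_sub_inner a, apply_eq_inner_sub_inner b, h, h]
    · exact monotone_indicator _ fun i k hik hi => hi.trans_le hik
    · simp only [Fin.lt_def, Fin.val_castSucc, Fin.val_succ]
      split_ifs <;> first | omega | rfl
    · exact monotone_indicator _ fun i k hik hi => hi.trans hik
    · simp only [Fin.le_def, Fin.val_castSucc, Fin.val_succ]
      split_ifs <;> first | omega | rfl
  have hsum : a i.castSucc + a i.succ = b i.castSucc + b i.succ := by
    have h1 := h (WithLp.toLp 2 fun _ => 1) monotone_const rfl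
    simp only [EucSpace.inner_eq_sum, one_mul] at h1
    rw [← sub_eq_zero, ← Finset.sum_sub_distrib, Finset.sum_eq_add i.castSucc i.succ hne
      (fun j _ hj => sub_eq_zero.2 (hout j hj.1 hj.2)) (by simp) (by simp)] at h1
    linarith
  have hsq : a i.castSucc ^ 2 + a i.succ ^ 2 = b i.castSucc ^ 2 + b i.succ ^ 2 := by
    have h1 : ‖a‖ ^ 2 = ‖b‖ ^ 2 := by rw [hnorm]
    rw [EuclideanSpace.real_norm_sq_eq, EuclideanSpace.real_norm_sq_eq, ← sub_eq_zero,
      ← Finset.sum_sub_distrib, Finset.sum_eq_add i.castSucc i.succ hne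
      (fun j _ hj => by rw [hout j hj.1 hj.2, sub_self]) (by simp) (by simp)] at h1
    linarith
  -- The sum and the sum of squares determine a pair of numbers up to order.
  have hprod : (b i.castSucc - a i.castSucc) * (b i.castSucc - a i.succ) = 0 := by
    have : a i.succ = b i.castSucc + b i.succ - a i.castSucc := by linarith
    rw [this] at hsq ⊢
    nlinarith
  rcases mul_eq_zero.1 hprod with h0 | h0
  · refine absurd ?_ hab
    ext j
    by_cases h1 : j = i.castSucc
    · rw [h1]; linarith
    by_cases h2 : j = i.succ
    · rw [h2]; linarith
    exact hout j h1 h2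
  · ext j
    rw [permuteCoords_apply]
    by_cases h1 : j = i.castSucc
    · rw [h1, Equiv.swap_apply_left]; linarith
    by_cases h2 : j = i.succ
    · rw [h2, Equiv.swap_apply_right]; linarith
    rw [Equiv.swap_apply_of_ne_of_ne h1 h2, hout j h1 h2]

theorem mem_extremePoints_of_maxFace_eq_singleton {P : Set (EucSpace d)} {c v : EucSpace d}
    (h : maxFace P c = {v}) : v ∈ Set.extremePoints ℝ P := by
  have hv : v ∈ maxFace P c := h ▸ rfl
  refine mem_extremePoints_iff_left.2 ⟨hv.1, fun x hx y hy hxy => ?_⟩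
  obtain ⟨s, t, hs, ht, hst, rfl⟩ := hxy
  have hxmax : inner ℝ c (s • x + t • y) ≤ inner ℝ c x := by
    have h2 := hv.2 y hy
    rw [inner_add_right, inner_smul_right, inner_smul_right] at h2 ⊢
    obtain rfl : s = 1 - t := by linarith
    nlinarith
  have hmem : x ∈ maxFace P c := ⟨hx, fun w hw => (hv.2 w hw).trans hxmax⟩
  rw [h] at hmem
  exact hmem

/-- The vertices of a polytope whose normal fan is the fan of the braid arrangement. -/
theorem exists_vertices_of_normalFan_eq_braidFan {P : Set (EucSpace d)}
    (hP : normalFan P = braidFan d) (τ : Equiv.Perm (Fin d)) :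
    ∃ v ∈ Set.extremePoints ℝ P, ∀ c, v ∈ maxFace P c ↔ c ∈ braidCone τ := by
  obtain ⟨F, ⟨⟨v, hv⟩, c₀, hF⟩, hcone⟩ : braidCone τ ∈ normalFan P :=
    hP ▸ braidCone_mem_braidFan τ
  have hsingle : F = {v} := by
    refine Set.eq_singleton_iff_unique_mem.2 ⟨hv, fun y hy => ?_⟩
    -- All of `braidCone τ` is constant on `F`, and this cone spans the space.
    have hu : permuteCoords τ (y - v) = 0 := by
      refine eq_zero_of_inner_monotone_eq_zero fun g hg => ?_
      have hmem : permuteCoords τ⁻¹ g ∈ normalConeAt P F :=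
        hcone ▸ permuteCoords_inv_mem_braidCone τ hg
      rw [← inner_permuteCoords_inv, inner_sub_right, sub_eq_zero]
      exact le_antisymm ((hmem hv).2 y (hmem hy).1) ((hmem hy).2 v (hmem hv).1)
    rw [← norm_eq_zero, norm_permuteCoords, norm_eq_zero] at hu
    exact sub_eq_zero.1 hu
  refine ⟨v, mem_extremePoints_of_maxFace_eq_singleton (hF.symm.trans hsingle), fun c => ?_⟩
  rw [hcone, hsingle]
  simp [normalConeAt]

/-- An inscribed polytope with the fan of the braid arrangement is a translate of a permutahedron:
seen from the center, the vertices on both sides of a wall are mirror images in this wall. -/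
theorem exists_eq_vadd_permutahedron {n : ℕ} {P : Set (EucSpace (n + 1))} (hconv : Convex ℝ P)
    (hP : normalFan P = braidFan (n + 1)) (hins : IsInscribed P) :
    ∃ c z : EucSpace (n + 1), P = c +ᵥ permutahedron z := by
  choose v hv hvc using exists_vertices_of_normalFan_eq_braidFan hP
  obtain ⟨c, r, -, hsphere⟩ := hins
  -- The vertex seen from `c`, carried back to the sorted region, does not change when a wall is
  -- crossed.
  have hadj : ∀ (τ : Equiv.Perm (Fin (n + 1))) (i : Fin n),
      permuteCoords (τ * Equiv.swap i.castSucc i.succ)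
        (v (τ * Equiv.swap i.castSucc i.succ) - c) = permuteCoords τ (v τ - c) := by
    intro τ i
    set s := Equiv.swap i.castSucc i.succ with hs
    have h := eq_permuteCoords_swap (a := permuteCoords τ (v τ - c))
      (b := permuteCoords τ (v (τ * s) - c)) i ?_ ?_ ?_
    · rw [← permuteCoords_permuteCoords, h, permuteCoords_permuteCoords, ← hs, hs,
        Equiv.swap_mul_self]
      rfl
    · intro g hg hgi
      have h1 : v τ ∈ maxFace P (permuteCoords τ⁻¹ g) :=
        (hvc _ _).2 (permuteCoords_inv_mem_braidCone τ hg)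
      have h2 : v (τ * s) ∈ maxFace P (permuteCoords τ⁻¹ g) := by
        refine (hvc _ _).2 ?_
        have : permuteCoords τ⁻¹ g = permuteCoords (τ * s)⁻¹ g := by
          rw [mul_inv_rev, ← permuteCoords_permuteCoords]
          congr 1
          ext j
          rw [permuteCoords_apply, hs, Equiv.swap_inv]
          by_cases h2 : j = i.castSucc
          · rw [h2, Equiv.swap_apply_left, hgi]
          by_cases h3 : j = i.succ
          · rw [h3, Equiv.swap_apply_right, hgi]
          rw [Equiv.swap_apply_of_ne_of_ne h2 h3]
        rw [this]
        exact permuteCoords_inv_mem_braidCone _ hg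
      rw [← inner_permuteCoords_inv, ← inner_permuteCoords_inv, inner_sub_right, inner_sub_right,
        le_antisymm (h2.2 _ h1.1) (h1.2 _ h2.1)]
    · rw [norm_permuteCoords, norm_permuteCoords, ← dist_eq_norm, ← dist_eq_norm,
        hsphere (hv _), hsphere (hv _)]
    -- If the two vertices coincided, their cones would too, but `braidPoint τ` lies strictly on one
    -- side of the wall.
    · intro heq
      have hveq : v τ = v (τ * s) := by
        exact sub_left_injective (permuteCoords_injective τ heq)
      have hmem : braidPoint τ ∈ braidCone (τ * s) := by
        rw [← hvc, ← hveq, hvc]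
        exact (braidPoint_mem_braidChamber τ).monotone
      have := hmem i.castSucc_lt_succ.le
      simp [hs, braidPoint_apply_apply] at this
      linarith
  have hall : ∀ τ, permuteCoords τ (v τ - c) = v 1 - c := by
    intro τ
    induction τ using Submonoid.induction_of_closure_eq_top_right
      (Equiv.Perm.mclosure_swap_castSucc_succ n) with
    | one => rfl
    | mul_right τ s hs ih =>
      obtain ⟨i, rfl⟩ := hs
      rw [hadj, ih]
  have hv' : ∀ τ, v τ = c + permuteCoords τ⁻¹ (v 1 - c) := by
    intro τ
    rw [← hall τ, permuteCoords_permuteCoords, mul_inv_cancel]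
    exact (add_sub_cancel c (v τ)).symm
  refine ⟨c, v 1 - c, Set.Subset.antisymm (fun x hx => ?_) ?_⟩
  · refine mem_of_forall_exists_inner_le ((convex_permutahedron _).vadd c)
      ((isCompact_permutahedron _).vadd c).isClosed fun e => ?_
    refine ⟨v (Tuple.sort fun i => e i), ?_, ?_⟩
    · rw [hv' (Tuple.sort fun i => e i)]
      exact Set.vadd_mem_vadd_set (permuteCoords_mem_permutahedron _ _)
    · exact ((hvc _ e).2 (Tuple.monotone_sort fun i => e i)).2 x hx
  · rw [permutahedron, ← convexHull_vadd]
    refine convexHull_min ?_ hconv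
    rintro _ ⟨_, ⟨σ, rfl⟩, rfl⟩
    have := hv' σ⁻¹
    rw [inv_inv] at this
    simp only [vadd_eq_add, ← this]
    exact (hv _).1

theorem permutahedron_const (m : ℝ) :
    permutahedron (WithLp.toLp 2 fun _ => m : EucSpace d) = {WithLp.toLp 2 fun _ => m} := by
  have h : (fun σ : Equiv.Perm (Fin d) => permuteCoords σ (WithLp.toLp 2 fun _ => m)) =
    fun _ => WithLp.toLp 2 fun _ => m := rfl
  rw [permutahedron, h, Set.range_const, convexHull_singleton]

/-- Sorting `z` does not change `P(z)`, and moving its mean into `c` is a shift along `(1, …, 1)`.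
Sum zero puts the origin into `P(z')`, so that `c'` lies in the polytope. -/
theorem exists_monotone_sum_eq_zero {n : ℕ} (c z : EucSpace (n + 1)) :
    ∃ c' z' : EucSpace (n + 1), (Monotone fun i => z' i) ∧ ∑ i, z' i = 0 ∧
      c +ᵥ permutahedron z = c' +ᵥ permutahedron z' := by
  set ρ := Tuple.sort fun i => z i
  set m : EucSpace (n + 1) := WithLp.toLp 2 fun _ => (∑ i, z i) / (n + 1)
  have hz : Monotone fun i => permuteCoords ρ z i := Tuple.monotone_sort fun i => z i
  have hz' : Monotone fun i => (permuteCoords ρ z - m) i := fun i j hij =>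
    sub_le_sub_right (hz hij) _
  refine ⟨c + m, permuteCoords ρ z - m, hz', ?_, ?_⟩
  · simp only [PiLp.sub_apply, Finset.sum_sub_distrib, permuteCoords_apply, m]
    rw [Equiv.sum_comp ρ fun i => z i]
    simp
    field_simp
    simp
  · rw [← permutahedron_permuteCoords ρ]
    conv_lhs => rw [← add_sub_cancel m (permuteCoords ρ z)]
    rw [permutahedron_add monotone_const hz', permutahedron_const, Set.singleton_add, add_vadd]
    rfl

end BraidArrangement

/-! ### Limits in the Hausdorff metric. -/

section Closure

variable {d : ℕ}

theorem exists_mem_permutahedron_dist_le {c c' z z' x : EucSpace d}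
    (hx : x ∈ c +ᵥ permutahedron z) :
    ∃ y ∈ c' +ᵥ permutahedron z', dist x y ≤ dist c c' + dist z z' := by
  obtain ⟨p, hp, rfl⟩ := hx
  -- Orbit points with the same permutation are at distance `dist z z'`; convexity extends this
  -- bound to the hull.
  have hconv : Convex ℝ {p : EucSpace d | ∃ q ∈ permutahedron z', dist p q ≤ dist z z'} := by
    rintro p ⟨q, hq, hpq⟩ p' ⟨q', hq', hpq'⟩ a b ha hb hab
    refine ⟨a • q + b • q', convex_permutahedron z' hq hq' ha hb hab, ?_⟩
    calc dist (a • p + b • p') (a • q + b • q')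
        ≤ dist (a • p) (a • q) + dist (b • p') (b • q') := dist_add_add_le _ _ _ _
      _ = a * dist p q + b * dist p' q' := by
          rw [dist_smul₀, dist_smul₀, Real.norm_of_nonneg ha, Real.norm_of_nonneg hb]
      _ ≤ a * dist z z' + b * dist z z' := by gcongr
      _ = dist z z' := by rw [← add_mul, hab, one_mul]
  obtain ⟨q, hq, hpq⟩ : p ∈ {p : EucSpace d | ∃ q ∈ permutahedron z', dist p q ≤ dist z z'} := by
    refine convexHull_min ?_ hconv hp
    rintro _ ⟨σ, rfl⟩
    refine ⟨_, permuteCoords_mem_permutahedron σ z', le_of_eq ?_⟩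
    rw [dist_eq_norm, dist_eq_norm]
    exact norm_permuteCoords σ (z - z')
  exact ⟨c' + q, Set.vadd_mem_vadd_set hq, (dist_add_add_le _ _ _ _).trans (by gcongr)⟩

theorem hausdorffDist_vadd_permutahedron_le (c c' z z' : EucSpace d) :
    Metric.hausdorffDist (c +ᵥ permutahedron z) (c' +ᵥ permutahedron z') ≤
      dist c c' + dist z z' := by
  refine Metric.hausdorffDist_le_of_mem_dist (by positivity)
    (fun x hx => exists_mem_permutahedron_dist_le hx) fun x hx => ?_
  rw [dist_comm c, dist_comm z]
  exact exists_mem_permutahedron_dist_le hx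

/-- The translate `c + P(z)`, as a non-empty compact set. -/
noncomputable def permutahedronCompacts (p : EucSpace d × EucSpace d) :
    NonemptyCompacts (EucSpace d) where
  carrier := p.1 +ᵥ permutahedron p.2
  isCompact' := (isCompact_permutahedron p.2).vadd p.1
  nonempty' := ⟨_, Set.vadd_mem_vadd_set (permuteCoords_mem_permutahedron 1 p.2)⟩

theorem coe_permutahedronCompacts (p : EucSpace d × EucSpace d) :
    (permutahedronCompacts p : Set (EucSpace d)) = p.1 +ᵥ permutahedron p.2 := rfl

theorem continuous_permutahedronCompacts : Continuous (permutahedronCompacts (d := d)) := by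
  refine (LipschitzWith.of_dist_le_mul (K := 2) fun p q => ?_).continuous
  refine (hausdorffDist_vadd_permutahedron_le _ _ _ _).trans ?_
  have h1 : dist p.1 q.1 ≤ dist p q := le_max_left _ _
  have h2 : dist p.2 q.2 ≤ dist p q := le_max_right _ _
  norm_num
  linarith

/-- The pairs of a center `c` and a monotone vector `z` with entries summing to `0`. -/
def centeredMonotonePairs (n : ℕ) : Set (EucSpace (n + 1) × EucSpace (n + 1)) :=
  {p | (Monotone fun i => p.2 i) ∧ ∑ i, p.2 i = 0}

theorem isClosed_centeredMonotonePairs (n : ℕ) : IsClosed (centeredMonotonePairs n) := by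
  have hmono : IsClosed {p : EucSpace (n + 1) × EucSpace (n + 1) | Monotone fun i => p.2 i} := by
    simp only [Monotone, Set.ofPred_forall]
    exact isClosed_iInter fun i => isClosed_iInter fun j => isClosed_iInter fun _ =>
      isClosed_le (by fun_prop) (by fun_prop)
  exact hmono.inter (isClosed_eq (by fun_prop) continuous_const)

/-- Convergent translates are uniformly bounded, which bounds their parameters. A convergent
subsequence of parameters then represents the limit, by continuity. -/
theorem isClosed_image_permutahedronCompacts (n : ℕ) :
    IsClosed (permutahedronCompacts '' centeredMonotonePairs n) := by
  refine IsSeqClosed.isClosed fun u P hu hP => ?_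
  choose p hp hpu using hu
  -- The parameter `0` gives the one-point set `{0}`, and the Hausdorff distance to it bounds the
  -- norms of all points.
  obtain ⟨R₀, hR₀⟩ := (Metric.isBounded_range_of_tendsto _ hP).subset_closedBall
    (permutahedronCompacts (0 : EucSpace (n + 1) × EucSpace (n + 1)))
  obtain ⟨R, hbound⟩ : ∃ R, ∀ k, ∀ x ∈ (p k).1 +ᵥ permutahedron (p k).2, ‖x‖ ≤ R := by
    refine ⟨R₀ + 1, fun k x hx => ?_⟩
    have hdist : Metric.hausdorffDist (permutahedronCompacts (p k) : Set (EucSpace (n + 1)))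
        (permutahedronCompacts (0 : EucSpace (n + 1) × EucSpace (n + 1))) < R₀ + 1 := by
      rw [hpu k]
      exact lt_of_le_of_lt (hR₀ (Set.mem_range_self k)) (lt_add_one _)
    obtain ⟨y, hy, hxy⟩ := Metric.exists_dist_lt_of_hausdorffDist_lt hx hdist
      (Metric.hausdorffEDist_ne_top_of_nonempty_of_bounded (permutahedronCompacts (p k)).nonempty
        (permutahedronCompacts 0).nonempty (permutahedronCompacts (p k)).isCompact.isBounded
        (permutahedronCompacts 0).isCompact.isBounded)
    have hy0 : y = 0 := by
      rw [coe_permutahedronCompacts, Prod.fst_zero, Prod.snd_zero, zero_vadd,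
        permutahedron_zero] at hy
      exact hy
    rw [hy0, dist_zero_right] at hxy
    exact hxy.le
  -- The center belongs to the polytope, since the entries of `(p k).2` sum to zero.
  have hc : ∀ k, ‖(p k).1‖ ≤ R := fun k => by
    have h0 := hbound k ((p k).1 + 0)
      (Set.vadd_mem_vadd_set (zero_mem_permutahedron (hp k).2))
    rwa [add_zero] at h0
  have hz : ∀ k, ‖(p k).2‖ ≤ R + R := fun k => by
    have h1 := hbound k ((p k).1 + (p k).2)
      (Set.vadd_mem_vadd_set (permuteCoords_mem_permutahedron 1 (p k).2))
    calc ‖(p k).2‖ = ‖(p k).1 + (p k).2 - (p k).1‖ := by rw [add_sub_cancel_left]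
      _ ≤ R + R := (norm_sub_le _ _).trans (add_le_add h1 (hc k))
  obtain ⟨q, -, φ, hφ, hq⟩ := tendsto_subseq_of_bounded
    (Metric.isBounded_closedBall (x := (0 : EucSpace (n + 1) × EucSpace (n + 1)))
      (r := max R (R + R))) (x := p) fun k => by
        rw [mem_closedBall_zero_iff]
        exact max_le_max (hc k) (hz k)
  refine ⟨q, (isClosed_centeredMonotonePairs n).mem_of_tendsto hq
    (Filter.Eventually.of_forall fun k => hp (φ k)), ?_⟩
  refine tendsto_nhds_unique ((continuous_permutahedronCompacts.tendsto q).comp hq) ?_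
  refine (hP.comp hφ.tendsto_atTop).congr fun k => (hpu (φ k)).symm

theorem inscribedCone_braidFan_subset (n : ℕ) :
    inscribedCone (braidFan (n + 1)) ⊆ permutahedronCompacts '' centeredMonotonePairs n := by
  rintro P ⟨⟨s, -, hs⟩, hins, hfan⟩
  obtain ⟨c, z, hP⟩ := exists_eq_vadd_permutahedron (hs ▸ convex_convexHull ℝ _) hfan hins
  obtain ⟨c', z', hmono, hsum, heq⟩ := exists_monotone_sum_eq_zero c z
  exact ⟨(c', z'), ⟨hmono, hsum⟩, NonemptyCompacts.ext (heq.symm.trans hP.symm)⟩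

theorem isInscribedCenter_vadd_permutahedron {n : ℕ} {c z : EucSpace (n + 1)}
    (hz : ∑ i, z i = 0) : IsInscribedCenter (c +ᵥ permutahedron z) c := by
  refine ⟨subset_affineSpan ℝ _ ?_, ‖z‖, ?_⟩
  · simpa using Set.vadd_mem_vadd_set (a := c) (zero_mem_permutahedron hz)
  · rw [permutahedron, ← convexHull_vadd]
    refine extremePoints_convexHull_subset.trans ?_
    rintro _ ⟨_, ⟨σ, rfl⟩, rfl⟩
    simp [norm_permuteCoords]

end Closure

/-- Here `d = n + 1`, the coordinates `z_1, …, z_d` are `z 0, …, z (Fin.last n)`, and the sum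
below is `z_1 Δ(d, d) + ∑_{i = 2}^{d} (z_i - z_{i-1}) Δ(d, d - i + 1)`, a Minkowski sum. -/
theorem mainTheorem9 (n : ℕ) (P : NonemptyCompacts (EucSpace (n + 1)))
    (hP : P ∈ closedInscribedCone (braidFan (n + 1))) :
    ∃ c : EucSpace (n + 1), IsInscribedCenter (P : Set (EucSpace (n + 1))) c ∧
      (∃ z : EucSpace (n + 1), (∀ i j : Fin (n + 1), i ≤ j → z i ≤ z j) ∧
        (-c) +ᵥ (P : Set (EucSpace (n + 1))) = permutahedron z ∧
        permutahedron z = z 0 • hypersimplex (n + 1) (n + 1) +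
          ∑ i : Fin n, (z i.succ - z i.castSucc) • hypersimplex (n + 1) (n - (i : ℕ))) ∧
      ∀ σ : Equiv.Perm (Fin (n + 1)),
        permuteCoords σ '' ((-c) +ᵥ (P : Set (EucSpace (n + 1)))) =
          (-c) +ᵥ (P : Set (EucSpace (n + 1))) := by
  -- The limit is again a translate `c + P(z)`, so the claims need only be checked for such sets.
  obtain ⟨⟨c, z⟩, ⟨hmono, hsum⟩, rfl⟩ :=
    closure_minimal (inscribedCone_braidFan_subset n) (isClosed_image_permutahedronCompacts n) hP
  have h : -c +ᵥ (permutahedronCompacts (c, z) : Set (EucSpace (n + 1))) = permutahedron z :=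
    neg_vadd_vadd c (permutahedron z)
  refine ⟨c, isInscribedCenter_vadd_permutahedron hsum,
    ⟨z, fun i j hij => hmono hij, h, permutahedron_eq_sum_hypersimplex hmono⟩, fun σ => ?_⟩
  rw [h, image_permuteCoords_permutahedron]
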